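/- Let $\gamma(x)=(2\pi)^{-n/2}e^{-|x|^2/2}$ be the standard Gaussian on $\mathbf R^n$, let $\gamma_\varepsilon(x)=\varepsilon^{-n}\gamma(x/\varepsilon)$ for $\varepsilon>0$, and write $\|u\|_{H^{1/2}}^2=\int_{\mathbf R^n}|\xi|\,|\widehat u(\xi)|^2\,d\xi$. For a measurable set $E\subset\mathbf R^n$ let $\mathbf 1_E$ be its indicator function and $P(E)=\sup\{\int_E \operatorname{div}T\,dx : T\in C_c^1(\mathbf R^n;\mathbf R^n),\ |T|\le 1\}\in[0,\infty]$ its perimeter. Theorem. There is a measurable set $F\subset[0,1]$ with $0<|F|<1$ such that, for every integer $n\ge 1$, the Cartesian power $E=F^n\subset[0,1]^n\subset\mathbf R^n$ satisfies $$P(E)=\infty\qquad\text{and}\qquad \liminf_{\varepsilon\to 0^+}\frac{1}{|\log\varepsilon|}\,\|\gamma_\varepsilon*\mathbf 1_E\|_{H^{1/2}}^2=0 .$$ In particular, in every dimension $n\ge1$ there is a set $E\subset\mathbf R^n$ of infinite perimeter for which this limit inferior vanishes. -/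

import Mathlib

open MeasureTheory Filter Topology
open scoped ENNReal FourierTransform Convolution

noncomputable section

/-- The standard Gaussian `γ(x) = (2π)^{-n/2} exp(-|x|²/2)` on `ℝⁿ`. -/
def stdGaussian (n : ℕ) (x : EuclideanSpace ℝ (Fin n)) : ℝ :=
  (2 * Real.pi) ^ (-(n : ℝ) / 2) * Real.exp (-‖x‖ ^ 2 / 2)

/-- The rescaled Gaussian `γ_ε(x) = ε^{-n} γ(x/ε)`. -/
def scaledGaussian (n : ℕ) (ε : ℝ) (x : EuclideanSpace ℝ (Fin n)) : ℝ :=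
  (ε ^ n)⁻¹ * stdGaussian n (ε⁻¹ • x)

/-- The mollified indicator function `γ_ε * 1_E` (Lebesgue measure on `ℝⁿ`). -/
def mollifiedIndicator {n : ℕ} (ε : ℝ) (E : Set (EuclideanSpace ℝ (Fin n))) :
    EuclideanSpace ℝ (Fin n) → ℝ :=
  scaledGaussian n ε ⋆[ContinuousLinearMap.lsmul ℝ ℝ, volume] E.indicator (fun _ => (1 : ℝ))

/-- The squared `H^{1/2}` norm `∫ |ξ| |û(ξ)|² dξ`, with values in `[0, ∞]`. It is meant for
integrable `u`, such as Schwartz functions, for which `û` is given by the Fourier integral. -/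
def sobolevHalfNormSq {n : ℕ} (u : EuclideanSpace ℝ (Fin n) → ℝ) : ℝ≥0∞ :=
  ∫⁻ ξ, ENNReal.ofReal (‖ξ‖ * ‖𝓕 (fun x => (u x : ℂ)) ξ‖ ^ 2)

/-- The divergence `∑ᵢ ∂ᵢ Tᵢ` of a vector field on `ℝⁿ`. -/
def vectorDiv {n : ℕ} (T : EuclideanSpace ℝ (Fin n) → EuclideanSpace ℝ (Fin n))
    (x : EuclideanSpace ℝ (Fin n)) : ℝ :=
  ∑ i : Fin n, (fderiv ℝ T x (EuclideanSpace.single i (1 : ℝ))) i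

/-- The (De Giorgi) perimeter
`P(E) = sup { ∫_E div T : T ∈ C_c^1(ℝⁿ; ℝⁿ), |T| ≤ 1 }`, with values in `[0, ∞]`
(the supremum is at least `0`, as `T = 0` shows). -/
def perimeter {n : ℕ} (E : Set (EuclideanSpace ℝ (Fin n))) : ℝ≥0∞ :=
  ⨆ (T : EuclideanSpace ℝ (Fin n) → EuclideanSpace ℝ (Fin n)) (_ : ContDiff ℝ 1 T)
    (_ : HasCompactSupport T) (_ : ∀ x, ‖T x‖ ≤ 1),
    ENNReal.ofReal (∫ x in E, vectorDiv T x)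

/-- The Cartesian power `Fⁿ ⊆ ℝⁿ` of a set `F ⊆ ℝ`. -/
def cartesianPower (n : ℕ) (F : Set ℝ) : Set (EuclideanSpace ℝ (Fin n)) :=
  {x | ∀ i, x i ∈ F}

end

/-! The set is a limit of smooth densities $u_k$ with values in $[0,1]$, where
$u_{k+1}=u_k+u_k(1-u_k)\sin(2\pi N_kx)$. Since $u_k$ is smooth, its $H^{1/2}$ seminorm is finite, so
a scale $\varepsilon_k$ can be picked with $|\log\varepsilon_k|$ far above its square. Only then is
$N_k$ chosen, so large that the new oscillation is almost invisible to mollification at the scales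
$\varepsilon_0,\dots,\varepsilon_k$ and to the pairings recorded so far (`exists_isRefinement`).
Later steps therefore barely change what was achieved at stage $k$.

The increments are almost orthogonal to all earlier densities, so the bounded sequence $u_k$ is
Cauchy in $L^2$ (`cauchySeq_of_almost_orthogonal`). The increments then tend to zero, but they are
comparable in $L^2$ to $u_k(1-u_k)$; hence the limit satisfies $G(1-G)=0$ and is an indicator
(`exists_indicator_limit`). Fatou's lemma carries the bounds at the scales $\varepsilon_k$ to the
limit, while the pairing with $N_k\sin(2\pi N_kx)$, a multiple of the derivative of a bounded
function, remains at least $k$ (`exists_oscillating_set`).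

For $F^n$, a plane wave in one coordinate gives infinite perimeter, because the pairing factors
through $|F|^{n-1}>0$. For the upper bound, $|\xi|\le\sum_i|\xi_i|$ and the product structure of the
Fourier transform reduce the seminorm to $n$ times the one-dimensional one
(`sobolevHalfNormSq_mollifiedIndicator_le`). -/

/-! ### Sine waves and the Riemann–Lebesgue lemma -/

/-- The sine wave of frequency `N`. -/
noncomputable def sineWave (N : ℕ) (x : ℝ) : ℝ := Real.sin (2 * Real.pi * N * x)

lemma continuous_sineWave (N : ℕ) : Continuous (sineWave N) := by
  unfold sineWave; fun_prop

lemma abs_sineWave_le_one (N : ℕ) (x : ℝ) : |sineWave N x| ≤ 1 := Real.abs_sin_le_one _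

lemma sineWave_eq_fourierChar (N : ℕ) (x : ℝ) :
    (sineWave N x : ℂ) = ((Real.fourierChar (N * x) : ℂ) - Real.fourierChar (-(N * x))) /
      (2 * Complex.I) := by
  rw [Real.fourierChar_apply, Real.fourierChar_apply, sineWave, Complex.ofReal_sin, Complex.sin]
  have h1 : -((2 * Real.pi * N * x : ℝ) : ℂ) * Complex.I =
    ((2 * Real.pi * (-(N * x)) : ℝ) : ℂ) * Complex.I := by push_cast; ring
  have h2 : ((2 * Real.pi * N * x : ℝ) : ℂ) * Complex.I =
    ((2 * Real.pi * (N * x) : ℝ) : ℂ) * Complex.I := by push_cast; ring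
  rw [h1, h2]
  field_simp
  rw [Complex.I_sq]
  ring

/-- The Riemann–Lebesgue lemma for the complex exponentials of integer frequency. -/
lemma tendsto_integral_fourierChar_natCast (f : ℝ → ℂ) :
    Tendsto (fun N : ℕ => ∫ x, (Real.fourierChar (-(x * N)) : ℂ) * f x) atTop (𝓝 0) := by
  have h := (Real.tendsto_integral_exp_smul_cocompact f).comp
    (tendsto_natCast_atTop_atTop.mono_right atTop_le_cocompact : Tendsto (fun N : ℕ => (N : ℝ)) atTop (cocompact ℝ))
  refine h.congr fun N => ?_
  simp [Circle.smul_def]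

lemma tendsto_integral_mul_sineWave {f : ℝ → ℝ} (hf : Integrable f) :
    Tendsto (fun N : ℕ => ∫ x, f x * sineWave N x) atTop (𝓝 0) := by
  have h := tendsto_integral_fourierChar_natCast (fun x => (f x : ℂ))
  have h2 := (Complex.continuous_im.tendsto 0).comp h
  rw [Complex.zero_im, ← neg_zero] at h2
  refine (h2.neg.congr fun N => ?_).trans (by simp)
  have hi : Integrable fun x => (Real.fourierChar (-(x * N)) : ℂ) * f x := by
    refine hf.ofReal.bdd_mul (c := 1) (by fun_prop) (.of_forall fun x => (Circle.norm_coe _).le)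
  simp only [Function.comp]
  rw [← RCLike.im_eq_complex_im, ← integral_im hi, ← integral_neg]
  refine integral_congr_ae (.of_forall fun x => ?_)
  simp only [RCLike.im_eq_complex_im, Real.fourierChar_apply, Complex.im_mul_ofReal,
    Complex.exp_ofReal_mul_I_im, sineWave]
  rw [show 2 * Real.pi * -(x * N) = -(2 * Real.pi * N * x) by ring, Real.sin_neg]
  ring

/-- Since $\sin^2\theta=(1-\cos2\theta)/2$, this is Riemann–Lebesgue at frequency $2N$. -/
lemma tendsto_integral_mul_sineWave_sq {f : ℝ → ℝ} (hf : Integrable f) :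
    Tendsto (fun N : ℕ => ∫ x, f x * sineWave N x ^ 2) atTop (𝓝 ((∫ x, f x) / 2)) := by
  have h := (tendsto_integral_fourierChar_natCast (fun x => (f x : ℂ))).comp
    (tendsto_id.const_mul_atTop' (r := 2) (by norm_num))
  have h2 := ((Complex.continuous_re.tendsto 0).comp h)
  rw [Complex.zero_re] at h2
  have h3 := ((h2.const_sub (∫ x, f x)).div_const 2)
  rw [sub_zero] at h3
  refine h3.congr fun N => ?_
  have hi : Integrable fun x => (Real.fourierChar (-(x * (2 * N : ℕ))) : ℂ) * f x := by
    refine hf.ofReal.bdd_mul (c := 1) (by fun_prop) (.of_forall fun x => (Circle.norm_coe _).le)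
  simp only [Function.comp, id]
  rw [← RCLike.re_eq_complex_re, ← integral_re hi, ← integral_sub hf hi.re,
    ← integral_div]
  refine integral_congr_ae (.of_forall fun x => ?_)
  simp only [RCLike.re_eq_complex_re, Real.fourierChar_apply, Complex.re_mul_ofReal,
    Complex.exp_ofReal_mul_I_re, sineWave]
  rw [show 2 * Real.pi * -(x * (2 * N : ℕ)) = -(2 * (2 * Real.pi * N * x)) by push_cast; ring,
    Real.cos_neg, Real.cos_two_mul, Real.cos_sq']
  ring

/-! ### The mollified half-derivative seminorm -/

/-- The multiplier `|ξ|^{1/2} exp(-2π²ε²ξ²)`: the half-derivative of the Gaussian mollifier. -/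
noncomputable def halfWeight (ε ξ : ℝ) : ℝ :=
  Real.sqrt |ξ| * Real.exp (-2 * Real.pi ^ 2 * ε ^ 2 * ξ ^ 2)

lemma continuous_halfWeight (ε : ℝ) : Continuous (halfWeight ε) := by
  unfold halfWeight; fun_prop

lemma halfWeight_nonneg (ε ξ : ℝ) : 0 ≤ halfWeight ε ξ := by
  unfold halfWeight; positivity

lemma halfWeight_le (ε ξ : ℝ) : halfWeight ε ξ ≤ halfWeight 0 ξ := by
  unfold halfWeight
  have : 0 ≤ Real.pi ^ 2 * ε ^ 2 * ξ ^ 2 := by positivity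
  refine mul_le_mul_of_nonneg_left (Real.exp_le_exp.2 ?_) (Real.sqrt_nonneg _)
  linarith

lemma tendsto_halfWeight_cocompact {ε : ℝ} (hε : 0 < ε) :
    Tendsto (halfWeight ε) (cocompact ℝ) (𝓝 0) := by
  have h := tendsto_rpow_abs_mul_exp_neg_mul_sq_cocompact
    (a := 2 * Real.pi ^ 2 * ε ^ 2) (by positivity) (1 / 2)
  refine h.congr fun ξ => ?_
  rw [halfWeight, Real.sqrt_eq_rpow]
  ring_nf

lemma exists_halfWeight_le {ε : ℝ} (hε : 0 < ε) : ∃ B, ∀ ξ, halfWeight ε ξ ≤ B := by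
  let f : C(ℝ, ℝ) := ⟨halfWeight ε, continuous_halfWeight ε⟩
  obtain ⟨B, hB⟩ := (ZeroAtInftyContinuousMap.mk f (tendsto_halfWeight_cocompact hε)).isBounded_range.bddAbove
  exact ⟨B, fun ξ => hB ⟨ξ, rfl⟩⟩

/-- The `H^{1/2}` seminorm of the Gaussian mollification of `f` at scale `ε`. -/
noncomputable def mollifiedHalfNorm (ε : ℝ) (f : ℝ → ℝ) : ℝ≥0∞ :=
  eLpNorm (fun ξ => (halfWeight ε ξ : ℂ) * 𝓕 (fun x => (f x : ℂ)) ξ) 2 volume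

lemma continuous_fourier_ofReal {f : ℝ → ℝ} (hf : Integrable f) :
    Continuous (𝓕 (fun x => (f x : ℂ))) :=
  VectorFourier.fourierIntegral_continuous Real.continuous_fourierChar
    (by fun_prop) hf.ofReal

lemma mollifiedHalfNorm_add_le (ε : ℝ) {f g : ℝ → ℝ} (hf : Integrable f) (hg : Integrable g) :
    mollifiedHalfNorm ε (fun x => f x + g x) ≤ mollifiedHalfNorm ε f + mollifiedHalfNorm ε g := by
  have hc := continuous_halfWeight ε
  have h1 := continuous_fourier_ofReal hf
  have h2 := continuous_fourier_ofReal hg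
  unfold mollifiedHalfNorm
  refine le_trans (le_of_eq ?_) (eLpNorm_add_le ?_ ?_ (by norm_num))
  · congr 1
    ext ξ
    simp only [Pi.add_apply, ← mul_add]
    congr 1
    simp only [Complex.ofReal_add]
    rw [Real.fourier_real_eq, Real.fourier_real_eq, Real.fourier_real_eq, ← integral_add]
    · simp [smul_add]
    · exact (Real.fourierIntegral_convergent_iff (V := ℝ) ξ).2 hf.ofReal |>.congr (by simp [mul_comm])
    · exact (Real.fourierIntegral_convergent_iff (V := ℝ) ξ).2 hg.ofReal |>.congr (by simp [mul_comm])
  · exact (by fun_prop : Continuous _).aestronglyMeasurable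
  · exact (by fun_prop : Continuous _).aestronglyMeasurable

lemma mollifiedHalfNorm_le (ε : ℝ) (f : ℝ → ℝ) :
    mollifiedHalfNorm ε f ≤ mollifiedHalfNorm 0 f := by
  refine eLpNorm_mono fun ξ => ?_
  simp only [norm_mul, Complex.norm_real, Real.norm_eq_abs, abs_of_nonneg (halfWeight_nonneg _ _)]
  gcongr
  exact halfWeight_le ε ξ

/-- A smooth compactly supported real function, as a complex Schwartz function. -/
noncomputable def complexSchwartz {w : ℝ → ℝ} (hw : ContDiff ℝ ((⊤ : ℕ∞) : WithTop ℕ∞) w)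
    (hc : HasCompactSupport w) : SchwartzMap ℝ ℂ :=
  (hc.comp_left Complex.ofReal_zero).toSchwartzMap (Complex.ofRealCLM.contDiff.comp hw)

lemma complexSchwartz_apply {w : ℝ → ℝ} (hw : ContDiff ℝ ((⊤ : ℕ∞) : WithTop ℕ∞) w)
    (hc : HasCompactSupport w) (x : ℝ) : complexSchwartz hw hc x = w x := rfl

lemma fourier_complexSchwartz {w : ℝ → ℝ} (hw : ContDiff ℝ ((⊤ : ℕ∞) : WithTop ℕ∞) w)
    (hc : HasCompactSupport w) :
    ⇑(𝓕 (complexSchwartz hw hc) : SchwartzMap ℝ ℂ) = 𝓕 (fun x => (w x : ℂ)) := rfl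

/-- At $\varepsilon=0$ the weight is $|\xi|^{1/2}$ alone, and $|\xi||\hat w|^2\le C|\xi||\hat w|$ is
integrable because $\hat w$ is Schwartz. This bounds the mollified seminorms of $w$ uniformly in
$\varepsilon$. -/
lemma mollifiedHalfNorm_zero_lt_top {w : ℝ → ℝ} (hw : ContDiff ℝ ((⊤ : ℕ∞) : WithTop ℕ∞) w)
    (hc : HasCompactSupport w) : mollifiedHalfNorm 0 w < ∞ := by
  unfold mollifiedHalfNorm
  rw [← fourier_complexSchwartz hw hc]
  set f : SchwartzMap ℝ ℂ := 𝓕 (complexSchwartz hw hc)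
  have h3 : Integrable (fun ξ : ℝ => ‖ξ‖ ^ 1 * ‖f ξ‖) := f.integrable_pow_mul volume 1
  obtain ⟨C, hC⟩ := f.decay 0 0
  have hm : AEStronglyMeasurable (fun ξ => (halfWeight 0 ξ : ℂ) * f ξ) := by
    have := continuous_halfWeight 0
    exact (by fun_prop : Continuous _).aestronglyMeasurable
  refine ((memLp_two_iff_integrable_sq_norm hm).2 ?_).2
  refine (h3.const_mul C).mono' (hm.norm.pow 2) (.of_forall fun ξ => ?_)
  have hCx := hC.2 ξ
  simp only [pow_zero, norm_iteratedFDeriv_zero, one_mul] at hCx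
  simp only [halfWeight, norm_mul, norm_pow, Complex.norm_real, Real.norm_eq_abs, mul_pow, abs_norm]
  simp only [abs_of_nonneg (Real.sqrt_nonneg _), Real.sq_sqrt (abs_nonneg _)]
  simp only [ne_eq, OfNat.ofNat_ne_zero, not_false_eq_true, zero_pow, mul_zero, zero_mul,
    Real.exp_zero, abs_one, one_pow, mul_one, pow_one]
  nlinarith [abs_nonneg ξ, norm_nonneg (f ξ), mul_nonneg (abs_nonneg ξ) (norm_nonneg (f ξ))]

/-- For $\varepsilon>0$ the weight is bounded and vanishes at infinity. Moving the translation from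
$g$ to the weight makes the integrand tend to zero pointwise, dominated by $B^2|g|^2$. -/
lemma tendsto_eLpNorm_halfWeight_mul_shift {ε : ℝ} (hε : 0 < ε) {g : ℝ → ℂ} (hg : MemLp g 2 volume)
    {c : ℕ → ℝ} (hc : Tendsto c atTop (cocompact ℝ)) :
    Tendsto (fun N => eLpNorm (fun ξ => (halfWeight ε ξ : ℂ) * g (ξ - c N)) 2 volume) atTop (𝓝 0) := by
  obtain ⟨B, hB⟩ := exists_halfWeight_le hε
  have hshift : ∀ N, eLpNorm (fun ξ => (halfWeight ε ξ : ℂ) * g (ξ - c N)) 2 volume =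
      (∫⁻ ξ : ℝ, ‖(halfWeight ε (ξ + c N) : ℂ) * g ξ‖ₑ ^ 2) ^ (1 / 2 : ℝ) := by
    intro N
    rw [eLpNorm_eq_lintegral_rpow_enorm_toReal (by norm_num) (by norm_num)]
    simp only [ENNReal.toReal_ofNat, ENNReal.rpow_ofNat]
    congr 1
    rw [← lintegral_add_right_eq_self _ (c N)]
    simp
  simp_rw [hshift]
  have hfin : ∫⁻ ξ : ℝ, ‖g ξ‖ₑ ^ 2 ≠ ∞ := by
    have := hg.2
    rw [eLpNorm_lt_top_iff_lintegral_rpow_enorm_lt_top (by norm_num) (by norm_num)] at this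
    simpa using this.ne
  have key : Tendsto (fun N => ∫⁻ ξ : ℝ, ‖(halfWeight ε (ξ + c N) : ℂ) * g ξ‖ₑ ^ 2) atTop
      (𝓝 (∫⁻ _ : ℝ, 0)) := by
    refine tendsto_lintegral_of_dominated_convergence' (fun ξ : ℝ => ‖(B : ℂ)‖ₑ ^ 2 * ‖g ξ‖ₑ ^ 2) ?_ ?_ ?_ ?_
    · intro N
      have h1 : AEStronglyMeasurable (fun ξ => (halfWeight ε (ξ + c N) : ℂ)) :=
        (by have := continuous_halfWeight ε; fun_prop : Continuous _).aestronglyMeasurable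
      exact (h1.mul hg.1).enorm.pow_const 2
    · intro N
      refine .of_forall fun ξ => ?_
      simp only [enorm_mul, mul_pow]
      gcongr
      rw [enorm_le_iff_norm_le, Complex.norm_real, Complex.norm_real, Real.norm_eq_abs,
        Real.norm_eq_abs, abs_of_nonneg (halfWeight_nonneg _ _)]
      exact (hB _).trans (le_abs_self B)
    · rw [lintegral_const_mul' _ _ (by finiteness)]
      exact ENNReal.mul_ne_top (by finiteness) hfin
    · refine .of_forall fun ξ => ?_
      have h1 : Tendsto (fun N => ξ + c N) atTop (cocompact ℝ) :=
        (Homeomorph.addLeft ξ).isClosedEmbedding.tendsto_cocompact.comp hc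
      have h2 := (tendsto_halfWeight_cocompact hε).comp h1
      have h3 : Tendsto (fun N => (halfWeight ε (ξ + c N) : ℂ) * g ξ) atTop (𝓝 0) := by
        have := ((Complex.continuous_ofReal.tendsto 0).comp h2).mul_const (g ξ)
        simpa using this
      have := ENNReal.Tendsto.pow (n := 2) h3.enorm
      simpa using this
  simpa using key.ennrpow_const (1 / 2)

/-- Modulation by the sine wave splits $\hat w$ into two translates by $\pm N$, and the weight at a
fixed scale does not see frequencies that escape to infinity. -/
lemma tendsto_mollifiedHalfNorm_mul_sineWave {ε : ℝ} (hε : 0 < ε) {w : ℝ → ℝ}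
    (hw : ContDiff ℝ ((⊤ : ℕ∞) : WithTop ℕ∞) w) (hc : HasCompactSupport w) :
    Tendsto (fun N : ℕ => mollifiedHalfNorm ε (fun x => w x * sineWave N x)) atTop (𝓝 0) := by
  have hwi : Integrable (fun x => (w x : ℂ)) := (hw.continuous.integrable_of_hasCompactSupport hc).ofReal
  have hmem : MemLp (𝓕 (fun x => (w x : ℂ))) 2 volume := by
    rw [← fourier_complexSchwartz hw hc]; exact SchwartzMap.memLp _ 2 volume
  have hcont : Continuous (𝓕 (fun x => (w x : ℂ))) :=
    continuous_fourier_ofReal (hw.continuous.integrable_of_hasCompactSupport hc)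
  have hN : Tendsto (fun N : ℕ => (N : ℝ)) atTop (cocompact ℝ) :=
    tendsto_natCast_atTop_atTop.mono_right atTop_le_cocompact
  have hN' : Tendsto (fun N : ℕ => -(N : ℝ)) atTop (cocompact ℝ) :=
    (tendsto_neg_atTop_atBot.comp tendsto_natCast_atTop_atTop).mono_right atBot_le_cocompact
  have h1 := tendsto_eLpNorm_halfWeight_mul_shift hε hmem hN
  have h2 := tendsto_eLpNorm_halfWeight_mul_shift hε hmem hN'
  have h3 := h1.add h2
  rw [add_zero] at h3
  refine tendsto_of_tendsto_of_tendsto_of_le_of_le tendsto_const_nhds h3 (fun _ => zero_le) ?_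
  intro N
  have hs : ∀ c ξ : ℝ, ∫ x, (Real.fourierChar (-(x * ξ)) : ℂ) * (Real.fourierChar (c * x) * w x) =
      𝓕 (fun x => (w x : ℂ)) (ξ - c) := by
    intro c ξ
    rw [Real.fourier_real_eq]
    refine integral_congr_ae (.of_forall fun x => ?_)
    simp only [Circle.smul_def, smul_eq_mul, ← mul_assoc, ← Circle.coe_mul, ← AddChar.map_add_eq_mul]
    ring_nf
  have hint : ∀ c ξ : ℝ, Integrable fun x =>
      (Real.fourierChar (-(x * ξ)) : ℂ) * (Real.fourierChar (c * x) * w x) := by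
    intro c ξ
    refine (hwi.bdd_mul (c := 1) ?_ (.of_forall fun x => (Circle.norm_coe _).le)).bdd_mul (c := 1) ?_ (.of_forall fun x => (Circle.norm_coe _).le)
    · fun_prop
    · fun_prop
  have hF : ∀ ξ, 𝓕 (fun x => ((w x * sineWave N x : ℝ) : ℂ)) ξ =
      (𝓕 (fun x => (w x : ℂ)) (ξ - N) - 𝓕 (fun x => (w x : ℂ)) (ξ - -N)) / (2 * Complex.I) := by
    intro ξ
    rw [← hs N ξ, ← hs (-N) ξ, ← integral_sub (hint _ _) (hint _ _), Real.fourier_real_eq,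
      ← integral_div]
    refine integral_congr_ae (.of_forall fun x => ?_)
    simp only [Circle.smul_def, smul_eq_mul, Complex.ofReal_mul, sineWave_eq_fourierChar, neg_mul]
    ring
  have hwc := continuous_halfWeight ε
  refine le_trans ?_ (eLpNorm_sub_le ?_ ?_ (by norm_num))
  · refine eLpNorm_mono fun ξ => ?_
    rw [hF, Pi.sub_apply, ← mul_sub, norm_mul, norm_mul, norm_div]
    gcongr
    refine div_le_self (norm_nonneg _) (by simp)
  · exact (by fun_prop : Continuous _).aestronglyMeasurable
  · exact (by fun_prop : Continuous _).aestronglyMeasurable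

/-! ### Smooth densities and their oscillations -/

/-- A smooth density with values in `[0, 1]`, supported in `[1/4, 3/4]`, and not an indicator. -/
structure IsProfile (u : ℝ → ℝ) : Prop where
  contDiff : ContDiff ℝ ((⊤ : ℕ∞) : WithTop ℕ∞) u
  nonneg : ∀ x, 0 ≤ u x
  le_one : ∀ x, u x ≤ 1
  eq_zero : ∀ x, x ∉ Set.Icc (1 / 4 : ℝ) (3 / 4) → u x = 0
  exists_mem_Ioo : ∃ x, 0 < u x ∧ u x < 1

namespace IsProfile

variable {u : ℝ → ℝ}

lemma hasCompactSupport (h : IsProfile u) : HasCompactSupport u :=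
  HasCompactSupport.intro isCompact_Icc h.eq_zero

lemma integrable (h : IsProfile u) : Integrable u :=
  h.contDiff.continuous.integrable_of_hasCompactSupport h.hasCompactSupport

lemma memLp (h : IsProfile u) : MemLp u 2 volume :=
  h.contDiff.continuous.memLp_of_hasCompactSupport h.hasCompactSupport

lemma norm_le_indicator (h : IsProfile u) (x : ℝ) :
    ‖u x‖ ≤ (Set.Icc (1 / 4 : ℝ) (3 / 4)).indicator (fun _ => (1 : ℝ)) x := by
  by_cases hx : x ∈ Set.Icc (1 / 4 : ℝ) (3 / 4)
  · rw [Set.indicator_of_mem hx, Real.norm_of_nonneg (h.nonneg x)]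
    exact h.le_one x
  · rw [h.eq_zero x hx, Set.indicator_of_notMem hx, norm_zero]

lemma integral_sq_le_one (h : IsProfile u) : ∫ x, u x ^ 2 ≤ 1 := by
  have : ∫ x, u x ^ 2 ≤ ∫ x, (Set.Icc (1 / 4 : ℝ) (3 / 4)).indicator (fun _ => (1 : ℝ)) x := by
    refine integral_mono h.memLp.integrable_sq
      ((integrable_indicator_iff measurableSet_Icc).2 (by simp)) fun x => ?_
    have h1 := h.norm_le_indicator x
    rw [Real.norm_of_nonneg (h.nonneg x)] at h1
    exact le_trans (by nlinarith [h.nonneg x, h.le_one x]) h1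
  refine this.trans ?_
  rw [integral_indicator measurableSet_Icc]
  norm_num

/-- The available amplitude `u (1 - u)` of an oscillation that keeps values in `[0, 1]`. -/
lemma gap_contDiff (h : IsProfile u) :
    ContDiff ℝ ((⊤ : ℕ∞) : WithTop ℕ∞) (fun x => u x * (1 - u x)) :=
  h.contDiff.mul (contDiff_const.sub h.contDiff)

lemma gap_hasCompactSupport (h : IsProfile u) : HasCompactSupport (fun x => u x * (1 - u x)) :=
  h.hasCompactSupport.mul_right

lemma gap_nonneg (h : IsProfile u) (x : ℝ) : 0 ≤ u x * (1 - u x) :=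
  mul_nonneg (h.nonneg x) (sub_nonneg.2 (h.le_one x))

lemma integral_pos_of_gap_pow (h : IsProfile u) {p : ℕ} (hp : p ≠ 0) :
    0 < ∫ x, (u x * (1 - u x)) ^ p := by
  obtain ⟨x, hx0, hx1⟩ := h.exists_mem_Ioo
  refine Continuous.integral_pos_of_hasCompactSupport_nonneg_nonzero
    (h.gap_contDiff.continuous.pow p) ?_ (fun x => pow_nonneg (h.gap_nonneg x) p) (x := x) ?_
  · exact h.gap_hasCompactSupport.comp_left (g := fun y : ℝ => y ^ p) (by simp [hp])
  · exact pow_ne_zero _ (mul_pos hx0 (sub_pos.2 hx1)).ne'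

/-- Adding a full-amplitude oscillation to a profile gives a profile. -/
lemma add_oscillation (h : IsProfile u) (N : ℕ) :
    IsProfile (fun x => u x + u x * (1 - u x) * sineWave N x) where
  contDiff := by
    refine h.contDiff.add (h.gap_contDiff.mul ?_)
    unfold sineWave
    exact Real.contDiff_sin.comp (contDiff_const.mul contDiff_id)
  -- For $|s|\le1$ the value $u+u(1-u)s$ lies between $u^2$ and $1-(1-u)^2$, which yields both
  -- bounds and keeps a value strictly between $0$ and $1$ there.
  nonneg x := by
    have := abs_le.1 (abs_sineWave_le_one N x)
    nlinarith [h.gap_nonneg x, sq_nonneg (u x)]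
  le_one x := by
    have := abs_le.1 (abs_sineWave_le_one N x)
    nlinarith [h.gap_nonneg x, sq_nonneg (1 - u x)]
  eq_zero x hx := by simp [h.eq_zero x hx]
  exists_mem_Ioo := by
    obtain ⟨x, hx0, hx1⟩ := h.exists_mem_Ioo
    have := abs_le.1 (abs_sineWave_le_one N x)
    refine ⟨x, ?_, ?_⟩
    · nlinarith [h.gap_nonneg x, pow_pos hx0 2]
    · nlinarith [h.gap_nonneg x, pow_pos (sub_pos.2 hx1) 2]

end IsProfile

lemma exists_isProfile : ∃ u, IsProfile u := by
  let b : ContDiffBump (1 / 2 : ℝ) := ⟨1 / 8, 1 / 4, by norm_num, by norm_num⟩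
  refine ⟨fun x => 1 / 2 * b x, ⟨contDiff_const.mul b.contDiff, fun x => ?_, fun x => ?_,
    fun x hx => ?_, 1 / 2, ?_⟩⟩
  · have := b.nonneg (x := x); positivity
  · have := b.le_one (x := x); linarith
  · have : b x = 0 := by
      refine b.zero_of_le_dist ?_
      change 1 / 4 ≤ dist x (1 / 2)
      rw [Real.dist_eq]
      by_contra! hlt
      rw [abs_lt] at hlt
      exact hx ⟨by linarith, by linarith⟩
    simp [this]
  · have : b (1 / 2) = 1 := b.one_of_mem_closedBall (by simp [b])
    rw [this]; norm_num

/-! ### Control functionals and the refinement step -/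

/-- A functional that tends to zero along high frequency modulations of test functions. -/
def VanishesOnOscillations (C : (ℝ → ℝ) → ℝ≥0∞) : Prop :=
  ∀ w : ℝ → ℝ, ContDiff ℝ ((⊤ : ℕ∞) : WithTop ℕ∞) w → HasCompactSupport w →
    Tendsto (fun N : ℕ => C (fun x => w x * sineWave N x)) atTop (𝓝 0)

lemma VanishesOnOscillations.add {C D : (ℝ → ℝ) → ℝ≥0∞} (hC : VanishesOnOscillations C)
    (hD : VanishesOnOscillations D) : VanishesOnOscillations (fun f => C f + D f) := by
  intro w hw hc
  simpa using (hC w hw hc).add (hD w hw hc)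

lemma vanishesOnOscillations_integral {g : ℝ → ℝ} (hg : Continuous g) :
    VanishesOnOscillations (fun f => ENNReal.ofReal |∫ x, f x * g x|) := by
  intro w hw hc
  have hi : Integrable (fun x => w x * g x) :=
    (hw.continuous.mul hg).integrable_of_hasCompactSupport hc.mul_right
  have h := (ENNReal.tendsto_ofReal (tendsto_integral_mul_sineWave hi).abs)
  simp only [abs_zero, ENNReal.ofReal_zero] at h
  refine h.congr fun N => ?_
  simp only [mul_right_comm]

/-- The oscillating test function `N sin(2πNx)`. -/
noncomputable def waveTest (N : ℕ) (x : ℝ) : ℝ := N * sineWave N x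

lemma continuous_waveTest (N : ℕ) : Continuous (waveTest N) := by
  have := continuous_sineWave N
  unfold waveTest; fun_prop

/-- Without the factor $N$, the pairing with $u$ vanishes in the limit and the resonant term tends
to $\frac12\int u(1-u)>0$; the factor $N$ makes the product diverge. -/
lemma tendsto_integral_profile_mul_waveTest {u : ℝ → ℝ} (h : IsProfile u) :
    Tendsto (fun N : ℕ => ∫ x, (u x + u x * (1 - u x) * sineWave N x) * waveTest N x)
      atTop atTop := by
  have hgi : Integrable (fun x => u x * (1 - u x)) :=
    h.gap_contDiff.continuous.integrable_of_hasCompactSupport h.gap_hasCompactSupport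
  have hpos : 0 < ∫ x, u x * (1 - u x) := by simpa using h.integral_pos_of_gap_pow one_ne_zero
  have h1 := (tendsto_integral_mul_sineWave h.integrable).add (tendsto_integral_mul_sineWave_sq hgi)
  rw [zero_add] at h1
  have h2 := (tendsto_natCast_atTop_atTop (R := ℝ)).atTop_mul_pos (half_pos hpos) h1
  refine h2.congr fun N => ?_
  have hs := continuous_sineWave N
  rw [← integral_add, ← integral_const_mul]
  · refine integral_congr_ae (.of_forall fun x => ?_)
    simp only [waveTest]; ring
  · exact (h.contDiff.continuous.mul hs).integrable_of_hasCompactSupport h.hasCompactSupport.mul_right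
  · exact (h.gap_contDiff.continuous.mul (hs.pow 2)).integrable_of_hasCompactSupport
      h.gap_hasCompactSupport.mul_right

/-- A refinement of the density `u`, with control functional `C`, to `(u', C')`: the oscillation is
invisible to `D ≥ C`, which controls the mollification at the scale `ε`. -/
structure IsRefinement (k : ℕ) (u : ℝ → ℝ) (C : (ℝ → ℝ) → ℝ≥0∞) (ε : ℝ) (N : ℕ)
    (D : (ℝ → ℝ) → ℝ≥0∞) (u' : ℝ → ℝ) (C' : (ℝ → ℝ) → ℝ≥0∞) : Prop where
  eps_pos : 0 < ε
  eps_lt : ε < 1 / (k + 1)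
  norm_le : (mollifiedHalfNorm ε u + 1) ^ 2 ≤ ENNReal.ofReal (|Real.log ε| / (k + 1))
  control_le : ∀ f, C f ≤ D f
  le_control : ∀ f, D f ≤ C' f
  halfNorm_le : ∀ f, mollifiedHalfNorm ε f ≤ D f
  inner_le : ∀ f : ℝ → ℝ, ENNReal.ofReal |∫ x, f x * u x| ≤ D f
  wave_le : ∀ f : ℝ → ℝ, ENNReal.ofReal |∫ x, f x * waveTest N x| ≤ C' f
  small : D (fun x => u' x - u x) ≤ ENNReal.ofReal ((1 / 2) ^ (k + 1))
  wave_ge : (k : ℝ) + 1 ≤ ∫ x, u' x * waveTest N x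
  gap_le : (∫ x, (u x * (1 - u x)) ^ 2) ≤ 4 * ∫ x, (u' x - u x) ^ 2

lemma exists_scale (k : ℕ) {M : ℝ≥0∞} (hM : M < ∞) :
    ∃ ε : ℝ, 0 < ε ∧ ε < 1 / (k + 1) ∧ M ≤ ENNReal.ofReal (|Real.log ε| / (k + 1)) := by
  have h1 : Tendsto (fun ε : ℝ => |Real.log ε| / (k + 1)) (𝓝[>] 0) atTop :=
    (tendsto_abs_atBot_atTop.comp Real.tendsto_log_nhdsGT_zero).atTop_div_const (by positivity)
  have h2 := h1.eventually_ge_atTop M.toReal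
  have h3 : ∀ᶠ ε : ℝ in 𝓝[>] 0, ε < 1 / (k + 1) :=
    nhdsWithin_le_nhds (Iio_mem_nhds (by positivity))
  obtain ⟨ε, ha, hb, hc⟩ := (h2.and (h3.and self_mem_nhdsWithin)).exists
  exact ⟨ε, hc, hb, by rw [← ENNReal.ofReal_toReal hM.ne]; exact ENNReal.ofReal_le_ofReal ha⟩

/-- The scale depends only on $u$ and is fixed first. All requirements on the frequency then hold
eventually, so one $N$ meets them together. The new wave pairing enters $C'$ but not $D$: the
oscillation just added must be visible to it, the later ones must not. -/
lemma exists_isRefinement (k : ℕ) {u : ℝ → ℝ} (h : IsProfile u) {C : (ℝ → ℝ) → ℝ≥0∞}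
    (hC : VanishesOnOscillations C) :
    ∃ ε N D u' C', IsProfile u' ∧ VanishesOnOscillations C' ∧ IsRefinement k u C ε N D u' C' := by
  have hM := mollifiedHalfNorm_zero_lt_top h.contDiff h.hasCompactSupport
  obtain ⟨ε, hε0, hε1, hε⟩ := exists_scale k (M := (mollifiedHalfNorm 0 u + 1) ^ 2)
    (by finiteness)
  let D : (ℝ → ℝ) → ℝ≥0∞ := fun f => C f + mollifiedHalfNorm ε f + ENNReal.ofReal |∫ x, f x * u x|
  have hD : VanishesOnOscillations D :=
    (hC.add fun w hw hc => tendsto_mollifiedHalfNorm_mul_sineWave hε0 hw hc).add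
      (vanishesOnOscillations_integral h.contDiff.continuous)
  have h1 : ∀ᶠ N : ℕ in atTop, D (fun x => u x * (1 - u x) * sineWave N x) <
      ENNReal.ofReal ((1 / 2) ^ (k + 1)) :=
    (hD _ h.gap_contDiff h.gap_hasCompactSupport).eventually_lt_const (by simp)
  have h2 := (tendsto_integral_profile_mul_waveTest h).eventually_ge_atTop ((k : ℝ) + 1)
  have hsq : Integrable (fun x => (u x * (1 - u x)) ^ 2) :=
    (h.gap_contDiff.continuous.memLp_of_hasCompactSupport h.gap_hasCompactSupport).integrable_sq
  have hpos := h.integral_pos_of_gap_pow two_ne_zero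
  -- The limit is half the integral, so a quarter of it is eventually a lower bound; this is the
  -- factor $4$ in `gap_le`.
  have h3 := (tendsto_integral_mul_sineWave_sq hsq).eventually_const_le
    (u := (∫ x, (u x * (1 - u x)) ^ 2) / 4) (by linarith)
  obtain ⟨N, h1, h2, h3⟩ := (h1.and (h2.and h3)).exists
  refine ⟨ε, N, D, _, fun f => D f + ENNReal.ofReal |∫ x, f x * waveTest N x|,
    h.add_oscillation N, hD.add (vanishesOnOscillations_integral (continuous_waveTest N)), ?_⟩
  constructor
  · exact hε0
  · exact hε1
  · refine le_trans ?_ hε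
    gcongr
    exact mollifiedHalfNorm_le ε u
  · exact fun f => le_trans le_self_add le_self_add
  · exact fun f => le_self_add
  · exact fun f => le_trans le_add_self le_self_add
  · exact fun f => le_add_self
  · exact fun f => le_add_self
  · simpa using h1.le
  · exact h2
  · simp only [add_sub_cancel_left, mul_pow] at h3 ⊢
    linarith

/-- The whole sequence of refinements. -/
lemma exists_refinement_sequence :
    ∃ (u : ℕ → ℝ → ℝ) (C D : ℕ → (ℝ → ℝ) → ℝ≥0∞) (ε : ℕ → ℝ) (N : ℕ → ℕ),
      (∀ k, IsProfile (u k)) ∧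
      ∀ k, IsRefinement k (u k) (C k) (ε k) (N k) (D k) (u (k + 1)) (C (k + 1)) := by
  obtain ⟨u₀, hu₀⟩ := exists_isProfile
  let S := {p : (ℝ → ℝ) × ((ℝ → ℝ) → ℝ≥0∞) // IsProfile p.1 ∧ VanishesOnOscillations p.2}
  have step : ∀ (k : ℕ) (s : S), ∃ (t : S) (ε : ℝ) (N : ℕ) (D : (ℝ → ℝ) → ℝ≥0∞),
      IsRefinement k s.1.1 s.1.2 ε N D t.1.1 t.1.2 := by
    rintro k ⟨⟨u, C⟩, h, hC⟩
    obtain ⟨ε, N, D, u', C', hu', hC', hR⟩ := exists_isRefinement k h hC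
    exact ⟨⟨(u', C'), hu', hC'⟩, ε, N, D, hR⟩
  choose next ε N D hR using step
  let s : ℕ → S := fun k => Nat.rec ⟨(u₀, fun _ => 0), hu₀, fun _ _ _ => tendsto_const_nhds⟩
    (fun k s => next k s) k
  exact ⟨fun k => (s k).1.1, fun k => (s k).1.2, fun k => D k (s k), fun k => ε k (s k),
    fun k => N k (s k), fun k => (s k).2.1, fun k => hR k (s k)⟩

/-! ### Almost orthogonal increments in a Hilbert space -/

lemma sum_half_pow_le (j m : ℕ) (hjm : j ≤ m) :
    ∑ i ∈ Finset.Ico j m, (1 / 2 : ℝ) ^ (i + 1) ≤ (1 / 2) ^ j := by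
  suffices h : ∑ i ∈ Finset.Ico j m, (1 / 2 : ℝ) ^ (i + 1) = (1 / 2) ^ j - (1 / 2) ^ m by
    rw [h]; linarith [pow_pos (show (0 : ℝ) < 1 / 2 by norm_num) m]
  induction m, hjm using Nat.le_induction with
  | base => simp
  | succ m hm ih => rw [Finset.sum_Ico_succ_top hm, ih]; ring

/-- A bounded sequence in a Hilbert space whose increments are almost orthogonal to all previous
terms is a Cauchy sequence. -/
lemma cauchySeq_of_almost_orthogonal {E : Type*} [NormedAddCommGroup E] [InnerProductSpace ℝ E]
    {u : ℕ → E} {B : ℝ} (hB : ∀ m, ‖u m‖ ≤ B)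
    (h : ∀ j m, j ≤ m → |inner ℝ (u (m + 1) - u m) (u j)| ≤ (1 / 2) ^ (m + 1)) :
    CauchySeq u := by
  have hinner : ∀ j m, j ≤ m → |inner ℝ (u m - u j) (u j)| ≤ (1 / 2) ^ j := by
    intro j m hjm
    rw [← Finset.sum_Ico_sub u hjm, sum_inner]
    refine (Finset.abs_sum_le_sum_abs _ _).trans (le_trans (Finset.sum_le_sum fun i hi => ?_)
      (sum_half_pow_le j m hjm))
    exact h j i (Finset.mem_Ico.1 hi).1
  have hexp : ∀ j m, ‖u m - u j‖ ^ 2 = ‖u m‖ ^ 2 - ‖u j‖ ^ 2 - 2 * inner ℝ (u m - u j) (u j) := by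
    intro j m
    have := norm_add_sq_real (u m - u j) (u j)
    rw [sub_add_cancel] at this
    linarith
  -- The squared norms can drop by at most $2\cdot2^{-(j+1)}$ at step $j$, which is exactly the
  -- increase of the correction $-2\cdot2^{-j}$. So $b$ is monotone, and the squared norms converge.
  let b : ℕ → ℝ := fun j => ‖u j‖ ^ 2 - 2 * (1 / 2) ^ j
  have hmono : Monotone b := by
    refine monotone_nat_of_le_succ fun j => ?_
    have h1 := hexp j (j + 1)
    have h2 := abs_le.1 (h j j le_rfl)
    have h3 : (1 / 2 : ℝ) ^ (j + 1) = (1 / 2) ^ j / 2 := by ring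
    simp only [b]
    nlinarith [sq_nonneg ‖u (j + 1) - u j‖]
  have hbdd : BddAbove (Set.range b) := by
    refine ⟨B ^ 2, ?_⟩
    rintro _ ⟨j, rfl⟩
    have h1 : ‖u j‖ ^ 2 ≤ B ^ 2 := pow_le_pow_left₀ (norm_nonneg _) (hB j) 2
    have h2 : (0 : ℝ) ≤ (1 / 2) ^ j := by positivity
    simp only [b]; linarith
  have hpow : Tendsto (fun j : ℕ => (1 / 2 : ℝ) ^ j) atTop (𝓝 0) :=
    tendsto_pow_atTop_nhds_zero_of_lt_one (by norm_num) (by norm_num)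
  have hlim : Tendsto (fun j => ‖u j‖ ^ 2) atTop (𝓝 (⨆ j, b j)) := by
    have := (tendsto_atTop_ciSup hmono hbdd).add (hpow.const_mul 2)
    simpa [b] using this
  rw [Metric.cauchySeq_iff']
  intro δ hδ
  -- In `hexp` the difference of squared norms costs $\delta^2/4$ and twice the inner product costs
  -- $2\cdot\delta^2/4$, leaving a total below $\delta^2$.
  have hδ2 : 0 < δ ^ 2 / 4 := by positivity
  obtain ⟨K, hK⟩ := (hpow.eventually_lt_const hδ2).exists_forall_of_atTop
  obtain ⟨J', hJ'⟩ := Metric.cauchySeq_iff.1 hlim.cauchySeq _ hδ2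
  refine ⟨max J' K, fun m hm => ?_⟩
  have h1 := hJ' m (le_trans (le_max_left _ _) hm) (max J' K) (le_max_left _ _)
  have h2 := hK (max J' K) (le_max_right _ _)
  have h3 := abs_le.1 (hinner _ _ hm)
  rw [Real.dist_eq] at h1
  have h4 := (abs_lt.1 h1).2
  rw [dist_eq_norm]
  refine lt_of_pow_lt_pow_left₀ 2 hδ.le ?_
  rw [hexp]
  nlinarith

/-! ### Stability under later refinements and passage to the limit -/

section Limit

variable {u : ℕ → ℝ → ℝ} {C D : ℕ → (ℝ → ℝ) → ℝ≥0∞} {ε : ℕ → ℝ} {N : ℕ → ℕ}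

lemma control_mono
    (hR : ∀ k, IsRefinement k (u k) (C k) (ε k) (N k) (D k) (u (k + 1)) (C (k + 1)))
    {j m : ℕ} (h : j ≤ m) (f : ℝ → ℝ) : D j f ≤ D m f := by
  induction m, h using Nat.le_induction with
  | base => exact le_rfl
  | succ m _ ih => exact ih.trans (((hR m).le_control f).trans ((hR (m + 1)).control_le f))

lemma inner_increment_le
    (hR : ∀ k, IsRefinement k (u k) (C k) (ε k) (N k) (D k) (u (k + 1)) (C (k + 1)))
    {j m : ℕ} (h : j ≤ m) :
    |∫ x, (u (m + 1) x - u m x) * u j x| ≤ (1 / 2) ^ (m + 1) := by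
  rw [← ENNReal.ofReal_le_ofReal_iff (by positivity)]
  exact ((hR j).inner_le _).trans ((control_mono hR h _).trans (hR m).small)

/-- The wave of stage $j$ is controlled only from $C_{j+1}$ on, hence the shift in the index
condition. -/
lemma wave_increment_le
    (hR : ∀ k, IsRefinement k (u k) (C k) (ε k) (N k) (D k) (u (k + 1)) (C (k + 1)))
    {j m : ℕ} (h : j + 1 ≤ m) :
    |∫ x, (u (m + 1) x - u m x) * waveTest (N j) x| ≤ (1 / 2) ^ (m + 1) := by
  rw [← ENNReal.ofReal_le_ofReal_iff (by positivity)]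
  exact ((hR j).wave_le _).trans (((hR (j + 1)).control_le _).trans
    ((control_mono hR h _).trans (hR m).small))

/-- By the triangle inequality the increments after stage $k$ contribute at most a geometric sum
bounded by $1$; this is the $+1$ reserved in `norm_le`. -/
lemma halfNorm_le_add_one (hu : ∀ k, IsProfile (u k))
    (hR : ∀ k, IsRefinement k (u k) (C k) (ε k) (N k) (D k) (u (k + 1)) (C (k + 1)))
    {k m : ℕ} (h : k ≤ m) :
    mollifiedHalfNorm (ε k) (u m) ≤ mollifiedHalfNorm (ε k) (u k) + 1 := by
  have key : mollifiedHalfNorm (ε k) (u m) ≤ mollifiedHalfNorm (ε k) (u k) +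
      ENNReal.ofReal (∑ i ∈ Finset.Ico k m, (1 / 2 : ℝ) ^ (i + 1)) := by
    induction m, h using Nat.le_induction with
    | base => simp
    | succ m hm ih =>
      have h1 := mollifiedHalfNorm_add_le (ε k) (hu m).integrable
        ((hu (m + 1)).integrable.sub (hu m).integrable)
      simp only [Pi.sub_apply, add_sub_cancel] at h1
      rw [Finset.sum_Ico_succ_top hm, ENNReal.ofReal_add
        (Finset.sum_nonneg fun _ _ => by positivity) (by positivity), ← add_assoc]
      refine h1.trans (add_le_add ih ?_)
      exact ((hR k).halfNorm_le _).trans ((control_mono hR hm _).trans (hR m).small)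
  refine key.trans (add_le_add_right ?_ _)
  rw [← ENNReal.ofReal_one]
  exact ENNReal.ofReal_le_ofReal ((sum_half_pow_le k m h).trans
    (pow_le_one₀ (by norm_num) (by norm_num)))

lemma integrable_profile_mul {v : ℝ → ℝ} (h : IsProfile v) {g : ℝ → ℝ} (hg : Continuous g) :
    Integrable (fun x => v x * g x) :=
  (h.contDiff.continuous.mul hg).integrable_of_hasCompactSupport h.hasCompactSupport.mul_right

/-- The pairing is at least $k+1$ when the wave is introduced, and the later increments remove at
most $\sum_{i>k}2^{-(i+1)}\le1$. -/
lemma wave_ge_of_lt (hu : ∀ k, IsProfile (u k))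
    (hR : ∀ k, IsRefinement k (u k) (C k) (ε k) (N k) (D k) (u (k + 1)) (C (k + 1)))
    {k m : ℕ} (h : k + 1 ≤ m) : (k : ℝ) ≤ ∫ x, u m x * waveTest (N k) x := by
  have key : (k : ℝ) + 1 - ∑ i ∈ Finset.Ico (k + 1) m, (1 / 2 : ℝ) ^ (i + 1) ≤
      ∫ x, u m x * waveTest (N k) x := by
    induction m, h using Nat.le_induction with
    | base => simpa using (hR k).wave_ge
    | succ m hm ih =>
      have h1 := abs_le.1 (wave_increment_le hR hm)
      simp only [sub_mul] at h1
      rw [integral_sub (integrable_profile_mul (hu _) (continuous_waveTest _))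
        (integrable_profile_mul (hu _) (continuous_waveTest _))] at h1
      rw [Finset.sum_Ico_succ_top hm]
      linarith [h1.1]
  have h2 := sum_half_pow_le (k + 1) m h
  have h3 : (1 / 2 : ℝ) ^ (k + 1) ≤ 1 := pow_le_one₀ (by norm_num) (by norm_num)
  linarith

lemma inner_toLp_eq {f g : ℝ → ℝ} (hf : MemLp f 2 volume) (hg : MemLp g 2 volume) :
    inner ℝ (hf.toLp f) (hg.toLp g) = ∫ x, f x * g x := by
  rw [L2.inner_def]
  refine integral_congr_ae ?_
  filter_upwards [hf.coeFn_toLp, hg.coeFn_toLp] with x h1 h2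
  rw [h1, h2]
  simp [mul_comm]

lemma norm_toLp_sq_eq {f : ℝ → ℝ} (hf : MemLp f 2 volume) :
    ‖hf.toLp f‖ ^ 2 = ∫ x, f x ^ 2 := by
  rw [← real_inner_self_eq_norm_sq, inner_toLp_eq]
  simp only [pow_two]

/-- An $L^2$ limit $G$ exists by almost orthogonality. By `gap_le`,
$\|u_k(1-u_k)\|_2\le2\|u_{k+1}-u_k\|_2\to0$, so $G(1-G)=0$ almost everywhere. -/
lemma exists_indicator_limit (hu : ∀ k, IsProfile (u k))
    (hR : ∀ k, IsRefinement k (u k) (C k) (ε k) (N k) (D k) (u (k + 1)) (C (k + 1))) :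
    ∃ (F : Set ℝ) (ns : ℕ → ℕ), MeasurableSet F ∧ F ⊆ Set.Icc (1 / 4) (3 / 4) ∧ StrictMono ns ∧
      ∀ᵐ x, Tendsto (fun k => u (ns k) x) atTop (𝓝 (F.indicator (fun _ => (1 : ℝ)) x)) := by
  let U : ℕ → Lp ℝ 2 (volume : Measure ℝ) := fun k => (hu k).memLp.toLp (u k)
  have hcauchy : CauchySeq U := by
    refine cauchySeq_of_almost_orthogonal (B := 1) (fun m => ?_) fun j m hjm => ?_
    · rw [← sq_le_one_iff₀ (norm_nonneg _), norm_toLp_sq_eq]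
      exact (hu m).integral_sq_le_one
    · rw [← MemLp.toLp_sub, inner_toLp_eq]
      exact inner_increment_le hR hjm
  obtain ⟨G, hG⟩ := cauchySeq_tendsto_of_complete hcauchy
  have hgapLp : ∀ k, MemLp (fun x => u k x * (1 - u k x)) 2 volume := fun k =>
    (hu k).gap_contDiff.continuous.memLp_of_hasCompactSupport (hu k).gap_hasCompactSupport
  let W : ℕ → Lp ℝ 2 (volume : Measure ℝ) := fun k => (hgapLp k).toLp _
  have hW : Tendsto W atTop (𝓝 0) := by
    rw [tendsto_zero_iff_norm_tendsto_zero]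
    have h1 : Tendsto (fun k => 2 * ‖U (k + 1) - U k‖) atTop (𝓝 0) := by
      have := (((tendsto_add_atTop_iff_nat 1).2 hG).sub hG).norm.const_mul 2
      simpa using this
    refine squeeze_zero (fun _ => norm_nonneg _) (fun k => ?_) h1
    refine (pow_le_pow_iff_left₀ (norm_nonneg _) (by positivity) two_ne_zero).1 ?_
    rw [mul_pow, ← MemLp.toLp_sub, norm_toLp_sq_eq, norm_toLp_sq_eq]
    have := (hR k).gap_le
    simp only [Pi.sub_apply]
    linarith
  -- One subsequence makes $u_k$ converge almost everywhere, a further one does the same for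
  -- $u_k(1-u_k)$. Intersecting with the interval gives the inclusion everywhere, not just almost
  -- everywhere.
  obtain ⟨ns, hns, hae⟩ := (tendstoInMeasure_of_tendsto_Lp hG).exists_seq_tendsto_ae
  obtain ⟨ms, hms, hae'⟩ :=
    (tendstoInMeasure_of_tendsto_Lp (hW.comp hns.tendsto_atTop)).exists_seq_tendsto_ae
  refine ⟨{x | G x = 1} ∩ Set.Icc (1 / 4) (3 / 4), ns ∘ ms,
    (measurableSet_eq_fun (Lp.stronglyMeasurable G).measurable measurable_const).inter
      measurableSet_Icc, Set.inter_subset_right, hns.comp hms, ?_⟩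
  have hU : ∀ᵐ x, ∀ k, U k x = u k x := ae_all_iff.2 fun k => (hu k).memLp.coeFn_toLp
  have hWx : ∀ᵐ x, ∀ k, W k x = u k x * (1 - u k x) := ae_all_iff.2 fun k => (hgapLp k).coeFn_toLp
  filter_upwards [hae, hae', hU, hWx, Lp.coeFn_zero ℝ 2 (volume : Measure ℝ)] with x h1 h2 h3 h4 h5
  simp only [h3] at h1
  simp only [Function.comp, h4, h5, Pi.zero_apply] at h2
  have h6 : Tendsto (fun k => u (ns (ms k)) x) atTop (𝓝 (G x)) := h1.comp hms.tendsto_atTop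
  have h7 : G x * (1 - G x) = 0 :=
    tendsto_nhds_unique (h6.mul (h6.const_sub 1)) h2
  suffices h8 : ({x | G x = 1} ∩ Set.Icc (1 / 4) (3 / 4)).indicator (fun _ => (1 : ℝ)) x = G x by
    rw [h8]; exact h6
  by_cases hx : x ∈ Set.Icc (1 / 4 : ℝ) (3 / 4)
  · rcases mul_eq_zero.1 h7 with h8 | h8
    · rw [Set.indicator_of_notMem, h8]
      simp [h8]
    · have h9 : G x = 1 := by linarith
      have h10 : x ∈ {x | G x = 1} ∩ Set.Icc (1 / 4) (3 / 4) := ⟨h9, hx⟩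
      rw [Set.indicator_of_mem h10, h9]
  · rw [Set.indicator_of_notMem fun h => hx h.2]
    refine tendsto_nhds_unique (tendsto_const_nhds.congr fun k => ?_) h6
    exact ((hu _).eq_zero x hx).symm

end Limit

lemma tendsto_fourier_of_tendsto_profile {v : ℕ → ℝ → ℝ} (hv : ∀ k, IsProfile (v k)) {f : ℝ → ℝ}
    (h : ∀ᵐ x, Tendsto (fun k => v k x) atTop (𝓝 (f x))) (ξ : ℝ) :
    Tendsto (fun k => 𝓕 (fun x => (v k x : ℂ)) ξ) atTop (𝓝 (𝓕 (fun x => (f x : ℂ)) ξ)) := by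
  simp only [Real.fourier_real_eq]
  refine tendsto_integral_of_dominated_convergence
    ((Set.Icc (1 / 4 : ℝ) (3 / 4)).indicator fun _ => (1 : ℝ)) (fun k => ?_)
    ((integrable_indicator_iff measurableSet_Icc).2 (by simp)) (fun k => .of_forall fun x => ?_) ?_
  · have := (hv k).contDiff.continuous
    simp only [Circle.smul_def]
    exact (by fun_prop : Continuous _).aestronglyMeasurable
  · rw [Circle.norm_smul, Complex.norm_real]
    exact (hv k).norm_le_indicator x
  · filter_upwards [h] with x hx
    exact ((Complex.continuous_ofReal.tendsto _).comp hx).const_smul _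

/-- A subset of `[1/4, 3/4]` that oscillates at all frequencies, but along a sequence of scales has a
mollification of small half-derivative. -/
theorem exists_oscillating_set :
    ∃ F : Set ℝ, MeasurableSet F ∧ F ⊆ Set.Icc (1 / 4) (3 / 4) ∧
      (∀ k : ℕ, ∃ N : ℕ, (k : ℝ) ≤ ∫ x in F, waveTest N x) ∧
      (∀ k : ℕ, ∃ ε : ℝ, 0 < ε ∧ ε < 1 / (k + 1) ∧
        mollifiedHalfNorm ε (F.indicator fun _ => 1) ^ 2 ≤
          ENNReal.ofReal (|Real.log ε| / (k + 1))) ∧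
      ∫⁻ ξ : ℝ, ‖𝓕 (fun x => ((F.indicator (fun _ => (1 : ℝ)) x : ℝ) : ℂ)) ξ‖ₑ ^ 2 ≤ 1 := by
  obtain ⟨u, C, D, ε, N, hu, hR⟩ := exists_refinement_sequence
  obtain ⟨F, ns, hFm, hF, hns, hlim⟩ := exists_indicator_limit hu hR
  have hfour := tendsto_fourier_of_tendsto_profile (fun k => hu (ns k)) hlim
  refine ⟨F, hFm, hF, fun k => ⟨N k, ?_⟩, fun k => ⟨ε k, (hR k).eps_pos, (hR k).eps_lt, ?_⟩, ?_⟩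
  · have h1 : Tendsto (fun j => ∫ x, u (ns j) x * waveTest (N k) x) atTop
        (𝓝 (∫ x, F.indicator (fun _ => (1 : ℝ)) x * waveTest (N k) x)) := by
      refine tendsto_integral_of_dominated_convergence
        (fun x => (Set.Icc (1 / 4 : ℝ) (3 / 4)).indicator (fun _ => (1 : ℝ)) x * N k) (fun j => ?_)
        (((integrable_indicator_iff measurableSet_Icc).2 (by simp)).mul_const _)
        (fun j => .of_forall fun x => ?_) ?_
      · exact (integrable_profile_mul (hu _) (continuous_waveTest _)).aestronglyMeasurable
      · rw [norm_mul]
        gcongr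
        · exact Set.indicator_nonneg (fun _ _ => zero_le_one) x
        · exact (hu _).norm_le_indicator x
        · rw [waveTest, norm_mul, Real.norm_natCast]
          exact mul_le_of_le_one_right (by positivity) (abs_sineWave_le_one _ _)
      · filter_upwards [hlim] with x hx
        exact hx.mul_const _
    have h2 : ∫ x in F, waveTest (N k) x =
        ∫ x, F.indicator (fun _ => (1 : ℝ)) x * waveTest (N k) x := by
      rw [← integral_indicator hFm]
      refine integral_congr_ae (.of_forall fun x => ?_)
      by_cases hx : x ∈ F <;> simp [hx]
    rw [h2]
    refine ge_of_tendsto h1 ?_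
    filter_upwards [hns.tendsto_atTop.eventually_ge_atTop (k + 1)] with j hj
    exact wave_ge_of_lt hu hR hj
  · refine le_trans ?_ (hR k).norm_le
    gcongr
    have hw := continuous_halfWeight (ε k)
    -- Fatou's lemma on the Fourier side: the transforms converge at every frequency, so the
    -- seminorm at the fixed scale $\varepsilon_k$ is lower semicontinuous.
    have h1 := Lp.eLpNorm_lim_le_liminf_eLpNorm (p := 2) (μ := volume)
      (f := fun j ξ => (halfWeight (ε k) ξ : ℂ) * 𝓕 (fun x => (u (ns j) x : ℂ)) ξ)
      (fun j => by
        have := continuous_fourier_ofReal (hu (ns j)).integrable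
        exact (by fun_prop : Continuous _).aestronglyMeasurable)
      (fun ξ => (halfWeight (ε k) ξ : ℂ) *
        𝓕 (fun x => ((F.indicator (fun _ => (1 : ℝ)) x : ℝ) : ℂ)) ξ)
      (.of_forall fun ξ => (hfour ξ).const_mul _)
    refine h1.trans (liminf_le_of_frequently_le' (Eventually.frequently ?_))
    filter_upwards [hns.tendsto_atTop.eventually_ge_atTop k] with j hj
    exact halfNorm_le_add_one hu hR hj
  -- Plancherel is applied to the smooth densities, whose $L^2$ norms are at most $1$, and Fatou's
  -- lemma passes the bound to the indicator.
  · have h1 : ∀ ξ, ‖𝓕 (fun x => ((F.indicator (fun _ => (1 : ℝ)) x : ℝ) : ℂ)) ξ‖ₑ ^ 2 =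
        liminf (fun j => ‖𝓕 (fun x => (u (ns j) x : ℂ)) ξ‖ₑ ^ 2) atTop := fun ξ =>
      (ENNReal.Tendsto.pow (n := 2) (hfour ξ).enorm).liminf_eq.symm
    simp_rw [h1]
    refine (lintegral_liminf_le fun j => ?_).trans
      (liminf_le_of_frequently_le' (.of_forall fun j => ?_))
    · exact (continuous_fourier_ofReal (hu (ns j)).integrable).measurable.enorm.pow_const 2
    · have hc := (hu (ns j)).hasCompactSupport
      have h2 := SchwartzMap.integral_norm_sq_fourier (complexSchwartz (hu (ns j)).contDiff hc)
      have h3 : ∫ x, ‖complexSchwartz (hu (ns j)).contDiff hc x‖ ^ 2 = ∫ x, u (ns j) x ^ 2 := by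
        refine integral_congr_ae (.of_forall fun x => ?_)
        simp only [complexSchwartz_apply, Complex.norm_real, Real.norm_eq_abs, sq_abs]
      have h4 := (hu (ns j)).integral_sq_le_one
      rw [← h3, ← h2] at h4
      rw [← fourier_complexSchwartz (hu (ns j)).contDiff hc, ← ENNReal.ofReal_one]
      refine le_trans (le_of_eq ?_) (ENNReal.ofReal_le_ofReal h4)
      rw [ofReal_integral_eq_lintegral_ofReal]
      · refine lintegral_congr fun ξ => ?_
        rw [ENNReal.ofReal_pow (norm_nonneg _), ofReal_norm]
      · exact (memLp_two_iff_integrable_sq_norm (SchwartzMap.continuous _).aestronglyMeasurable).1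
          (SchwartzMap.memLp _ 2 volume)
      · exact .of_forall fun ξ => by positivity

/-! ### Cartesian powers and their perimeter -/

/-- Tonelli's theorem for a product of functions of the separate coordinates. -/
lemma lintegral_pi_prod_eq_prod {n : ℕ} {f : Fin n → ℝ → ℝ≥0∞} (hf : ∀ i, Measurable (f i)) :
    ∫⁻ x : Fin n → ℝ, ∏ i, f i (x i) = ∏ i, ∫⁻ t, f i t := by
  induction n with
  | zero =>
    have : volume (Set.univ : Set (Fin 0 → ℝ)) = 1 := by
      rw [volume_pi, Measure.pi_of_empty _ 0, measure_univ]
    simp [this]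
  | succ n ih =>
    rw [← ((volume_preserving_piFinSuccAbove (fun _ : Fin (n + 1) => ℝ) 0).symm).lintegral_comp_emb
      (MeasurableEquiv.measurableEmbedding _)]
    have hsplit : ∀ a : ℝ × (Fin n → ℝ),
        ∏ i, f i ((MeasurableEquiv.piFinSuccAbove (fun _ => ℝ) 0).symm a i) =
          f 0 a.1 * ∏ i : Fin n, f i.succ (a.2 i) := fun a => by
      rw [Fin.prod_univ_succ]; rfl
    simp_rw [hsplit, Fin.prod_univ_succ]
    have hm : Measurable fun y : Fin n → ℝ => ∏ i : Fin n, f i.succ (y i) :=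
      Finset.measurable_prod _ fun i _ => (hf i.succ).comp (measurable_pi_apply i)
    rw [← ih fun i => hf i.succ]
    exact lintegral_prod_mul (hf 0).aemeasurable hm.aemeasurable

section CartesianPower

variable {n : ℕ} {F : Set ℝ}

lemma measurableSet_cartesianPower (hF : MeasurableSet F) :
    MeasurableSet (cartesianPower n F) := by
  rw [cartesianPower, Set.ofPred_forall]
  exact MeasurableSet.iInter fun i => (by fun_prop : Measurable fun x : EuclideanSpace ℝ (Fin n) => x i) hF

lemma norm_lt_of_mem_cartesianPower (hF : F ⊆ Set.Icc 0 1) {x : EuclideanSpace ℝ (Fin n)}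
    (hx : x ∈ cartesianPower n F) : ‖x‖ < n + 1 := by
  refine lt_of_pow_lt_pow_left₀ 2 (by positivity) ?_
  rw [EuclideanSpace.real_norm_sq_eq]
  have : ∑ i, x i ^ 2 ≤ ∑ _i : Fin n, (1 : ℝ) :=
    Finset.sum_le_sum fun i _ => pow_le_one₀ (hF (hx i)).1 (hF (hx i)).2
  simp only [Finset.sum_const, Finset.card_univ, Fintype.card_fin, nsmul_eq_mul, mul_one] at this
  nlinarith [(Nat.cast_nonneg n : (0 : ℝ) ≤ n)]

lemma volume_cartesianPower_lt_top (hF : F ⊆ Set.Icc 0 1) :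
    volume (cartesianPower n F) < ∞ := by
  refine (measure_mono fun x hx => ?_).trans_lt (measure_ball_lt_top (x := 0) (r := (n : ℝ) + 1))
  simpa using norm_lt_of_mem_cartesianPower hF hx

lemma setIntegral_cartesianPower_prod {𝕜 : Type*} [RCLike 𝕜] (hF : MeasurableSet F)
    (g : Fin n → ℝ → 𝕜) :
    ∫ x in cartesianPower n F, ∏ i, g i (x i) = ∏ i, ∫ t in F, g i t := by
  rw [← integral_indicator (measurableSet_cartesianPower hF),
    ← (PiLp.volume_preserving_toLp (Fin n)).integral_comp
      (MeasurableEquiv.toLp 2 (Fin n → ℝ)).measurableEmbedding]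
  simp_rw [← integral_indicator hF]
  rw [← integral_fintype_prod_volume_eq_prod]
  refine integral_congr_ae (.of_forall fun y => ?_)
  by_cases hy : ∀ i, y i ∈ F
  · have h1 : WithLp.toLp 2 y ∈ cartesianPower n F := hy
    simp [h1, hy]
  · have h1 : WithLp.toLp 2 y ∉ cartesianPower n F := hy
    push Not at hy
    obtain ⟨i, hi⟩ := hy
    simp only [h1, not_false_eq_true, Set.indicator_of_notMem]
    exact (Finset.prod_eq_zero (Finset.mem_univ i) (by simp [hi])).symm

lemma vectorDiv_congr {T S : EuclideanSpace ℝ (Fin n) → EuclideanSpace ℝ (Fin n)}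
    {x : EuclideanSpace ℝ (Fin n)} (h : T =ᶠ[𝓝 x] S) : vectorDiv T x = vectorDiv S x := by
  simp only [vectorDiv, h.fderiv_eq]

lemma vectorDiv_coordinate {f : ℝ → ℝ} {f' : ℝ} (i : Fin n) {x : EuclideanSpace ℝ (Fin n)}
    (hf : HasDerivAt f f' (x i)) :
    vectorDiv (fun y => f (y i) • EuclideanSpace.single i (1 : ℝ)) x = f' := by
  have h1 : HasFDerivAt (fun y : EuclideanSpace ℝ (Fin n) => y i)
      (EuclideanSpace.proj i : EuclideanSpace ℝ (Fin n) →L[ℝ] ℝ) x :=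
    (EuclideanSpace.proj i : EuclideanSpace ℝ (Fin n) →L[ℝ] ℝ).hasFDerivAt
  have h2 := (hf.comp_hasFDerivAt x h1).smul_const (EuclideanSpace.single i (1 : ℝ))
  have h3 : fderiv ℝ (fun y : EuclideanSpace ℝ (Fin n) => f (y i) • EuclideanSpace.single i (1 : ℝ)) x = _ :=
    h2.fderiv
  simp only [vectorDiv, h3]
  rw [Finset.sum_eq_single i]
  · simp
  · intro j _ hj
    simp [hj]
  · simp

/-- Testing the perimeter of `Fⁿ` against a plane wave in one coordinate direction. -/
lemma ofReal_integral_waveTest_le_perimeter (hFm : MeasurableSet F)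
    (hF : F ⊆ Set.Icc 0 1) (i : Fin n) (N : ℕ) :
    ENNReal.ofReal (∫ x in cartesianPower n F, 2 * Real.pi * waveTest N (x i)) ≤
      perimeter (cartesianPower n F) := by
  -- The cutoff equals $1$ on the ball of radius $n+1$, whose interior contains $F^n$, so it does
  -- not affect the divergence there. The profile $-\cos(2\pi Nt)$ is bounded by $1$ and has
  -- derivative $2\pi N\sin(2\pi Nt)$.
  let X : ContDiffBump (0 : EuclideanSpace ℝ (Fin n)) :=
    ⟨n + 1, n + 2, by positivity, by linarith⟩
  let f : ℝ → ℝ := fun t => -Real.cos (2 * Real.pi * N * t)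
  let T : EuclideanSpace ℝ (Fin n) → EuclideanSpace ℝ (Fin n) :=
    fun x => (X x * f (x i)) • EuclideanSpace.single i (1 : ℝ)
  have hT1 : ContDiff ℝ 1 T := by
    have h1 : ContDiff ℝ 1 f := by fun_prop
    have h2 : ContDiff ℝ 1 X := X.contDiff
    have h3 : ContDiff ℝ 1 fun x : EuclideanSpace ℝ (Fin n) => x i := by fun_prop
    exact (h2.mul (h1.comp h3)).smul contDiff_const
  have hT2 : HasCompactSupport T := (X.hasCompactSupport.mul_right).smul_right
  have hT3 : ∀ x, ‖T x‖ ≤ 1 := by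
    intro x
    simp only [T, norm_smul, norm_mul, PiLp.norm_single, norm_one, mul_one]
    refine mul_le_one₀ ?_ (norm_nonneg _) ?_
    · rw [Real.norm_of_nonneg X.nonneg]; exact X.le_one
    · rw [norm_neg]; exact Real.abs_cos_le_one _
  refine le_trans (le_of_eq ?_) (le_iSup₂_of_le T hT1 (le_iSup₂_of_le hT2 hT3 le_rfl))
  congr 1
  refine setIntegral_congr_fun (measurableSet_cartesianPower hFm) fun x hx => ?_
  have hTx : T =ᶠ[𝓝 x] fun y => f (y i) • EuclideanSpace.single i (1 : ℝ) := by
    have hb : x ∈ Metric.ball (0 : EuclideanSpace ℝ (Fin n)) (n + 1) := by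
      simpa using norm_lt_of_mem_cartesianPower hF hx
    filter_upwards [Metric.isOpen_ball.mem_nhds hb] with y hy
    have : X y = 1 := X.one_of_mem_closedBall (Metric.ball_subset_closedBall hy)
    simp only [T, this, one_mul]
  have hd : HasDerivAt f (2 * Real.pi * waveTest N (x i)) (x i) := by
    have h1 := (((hasDerivAt_id (x i)).const_mul (2 * Real.pi * N)).cos).neg
    refine h1.congr_deriv ?_
    simp only [waveTest, sineWave, id]
    ring
  simp only [vectorDiv_congr hTx, vectorDiv_coordinate i hd]

end CartesianPower

/-- By Fubini the plane wave test gives $2\pi|F|^{n-1}\int_F N\sin(2\pi Nt)\,dt$, unbounded over $N$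
because $|F|>0$. -/
lemma perimeter_cartesianPower_eq_top {F : Set ℝ} (hFm : MeasurableSet F) (hF : F ⊆ Set.Icc 0 1)
    (h0 : 0 < volume F) (hw : ∀ k : ℕ, ∃ N : ℕ, (k : ℝ) ≤ ∫ x in F, waveTest N x)
    {n : ℕ} (hn : 0 < n) : perimeter (cartesianPower n F) = ⊤ := by
  obtain ⟨m, rfl⟩ : ∃ m, n = m + 1 := ⟨n - 1, by omega⟩
  have hpos : 0 < volume.real F :=
    ENNReal.toReal_pos h0.ne' ((measure_mono hF).trans_lt (by simp)).ne
  have hint : ∀ N : ℕ, ∫ x in cartesianPower (m + 1) F, 2 * Real.pi * waveTest N (x 0) =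
      2 * Real.pi * volume.real F ^ m * ∫ x in F, waveTest N x := by
    intro N
    have h := setIntegral_cartesianPower_prod (n := m + 1) hFm
      (Fin.cons (fun t => 2 * Real.pi * waveTest N t) fun _ _ => 1)
    simp only [Fin.prod_univ_succ, Fin.cons_zero, Fin.cons_succ, Finset.prod_const_one, mul_one] at h
    rw [h, integral_const_mul]
    simp
    ring
  refine ENNReal.eq_top_of_forall_nnreal_le fun r => ?_
  set c := 2 * Real.pi * volume.real F ^ m
  have hc : 0 < c := by positivity
  obtain ⟨k, hk⟩ := exists_nat_ge (r / c : ℝ)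
  obtain ⟨N, hN⟩ := hw k
  refine le_trans ?_ (ofReal_integral_waveTest_le_perimeter hFm hF 0 N)
  rw [hint, ← ENNReal.ofReal_coe_nnreal]
  refine ENNReal.ofReal_le_ofReal ?_
  rw [div_le_iff₀ hc] at hk
  nlinarith

/-! ### Reduction of the half-derivative norm to one dimension -/

section Fourier

variable {n : ℕ}

lemma fourier_scaledGaussian {ε : ℝ} (hε : 0 < ε) (ξ : EuclideanSpace ℝ (Fin n)) :
    𝓕 (fun x => (scaledGaussian n ε x : ℂ)) ξ =
      (Real.exp (-2 * Real.pi ^ 2 * ε ^ 2 * ‖ξ‖ ^ 2) : ℝ) := by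
  set b : ℝ := 1 / (2 * ε ^ 2) with hb
  have hb0 : 0 < b := by positivity
  set c : ℝ := (ε ^ n)⁻¹ * (2 * Real.pi) ^ (-(n : ℝ) / 2) with hc
  have h1 : (fun x => (scaledGaussian n ε x : ℂ)) =
      fun x => (c : ℂ) • Complex.exp (-(b : ℂ) * ‖x‖ ^ 2) := by
    ext x
    rw [scaledGaussian, stdGaussian, ← mul_assoc, smul_eq_mul, norm_smul, Complex.ofReal_mul, ← hc]
    congr 1
    rw [← Complex.ofReal_pow, ← Complex.ofReal_neg, ← Complex.ofReal_mul, ← Complex.ofReal_exp]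
    congr 2
    rw [hb, Real.norm_of_nonneg (by positivity)]
    field_simp
  have h2 : 𝓕 (fun x : EuclideanSpace ℝ (Fin n) => (c : ℂ) • Complex.exp (-(b : ℂ) * ‖x‖ ^ 2)) ξ =
      (c : ℂ) • 𝓕 (fun x : EuclideanSpace ℝ (Fin n) => Complex.exp (-(b : ℂ) * ‖x‖ ^ 2)) ξ := by
    simp only [Real.fourier_eq, smul_comm _ (c : ℂ), integral_smul]
  rw [h1, h2, fourier_gaussian_innerProductSpace (by simpa using hb0), finrank_euclideanSpace_fin,
    smul_eq_mul, ← mul_assoc]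
  have h3 : ((Real.pi : ℂ) / b) ^ ((n : ℂ) / 2) = (((Real.pi / b) ^ ((n : ℝ) / 2) : ℝ) : ℂ) := by
    rw [Complex.ofReal_cpow (by positivity)]
    push_cast; rfl
  have h4 : c * (Real.pi / b) ^ ((n : ℝ) / 2) = 1 := by
    have h5 : Real.pi / b = 2 * Real.pi * ε ^ 2 := by rw [hb]; field_simp
    rw [h5, Real.mul_rpow (by positivity) (by positivity), ← Real.rpow_natCast ε 2, ← Real.rpow_mul hε.le,
      hc, neg_div, Real.rpow_neg (by positivity)]
    have h6 : ((2 : ℕ) : ℝ) * ((n : ℝ) / 2) = n := by push_cast; ring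
    rw [h6, Real.rpow_natCast]
    have : (2 * Real.pi) ^ ((n : ℝ) / 2) ≠ 0 := (Real.rpow_pos_of_pos (by positivity) _).ne'
    field_simp
  rw [h3, ← Complex.ofReal_mul, h4, Complex.ofReal_one, one_mul, Complex.ofReal_exp]
  congr 1
  rw [hb]
  push_cast
  field_simp

lemma integrable_scaledGaussian {ε : ℝ} (hε : 0 < ε) : Integrable (scaledGaussian n ε) := by
  have h : Integrable fun x : EuclideanSpace ℝ (Fin n) => Real.exp (-(1 / 2) * ‖x‖ ^ 2) := by
    have := GaussianFourier.integrable_cexp_neg_mul_sq_norm_add (b := 1 / 2) (by norm_num) 0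
      (0 : EuclideanSpace ℝ (Fin n))
    refine this.norm.congr (.of_forall fun x => ?_)
    simp only [Complex.norm_exp]
    congr 1
    simp [← Complex.ofReal_pow]
  have h2 := ((h.const_mul ((2 * Real.pi) ^ (-(n : ℝ) / 2))).comp_smul (inv_ne_zero hε.ne')).const_mul
    (ε ^ n)⁻¹
  refine h2.congr (.of_forall fun x => ?_)
  simp only [scaledGaussian, stdGaussian]
  rw [show -(1 / 2) * ‖ε⁻¹ • x‖ ^ 2 = -‖ε⁻¹ • x‖ ^ 2 / 2 by ring]

variable {F : Set ℝ}

lemma fourier_indicator_cartesianPower (hFm : MeasurableSet F) (ξ : EuclideanSpace ℝ (Fin n)) :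
    𝓕 (fun x => (((cartesianPower n F).indicator (fun _ => (1 : ℝ)) x : ℝ) : ℂ)) ξ =
      ∏ i, 𝓕 (fun t => ((F.indicator (fun _ => (1 : ℝ)) t : ℝ) : ℂ)) (ξ i) := by
  have h1 : ∀ s : ℝ, 𝓕 (fun t => ((F.indicator (fun _ => (1 : ℝ)) t : ℝ) : ℂ)) s =
      ∫ t in F, (Real.fourierChar (-(t * s)) : ℂ) := by
    intro s
    rw [Real.fourier_real_eq, ← integral_indicator hFm]
    refine integral_congr_ae (.of_forall fun t => ?_)
    by_cases ht : t ∈ F <;> simp [ht, Circle.smul_def]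
  simp_rw [h1]
  rw [← setIntegral_cartesianPower_prod hFm fun i t => (Real.fourierChar (-(t * ξ i)) : ℂ),
    Real.fourier_eq, ← integral_indicator (measurableSet_cartesianPower hFm)]
  refine integral_congr_ae (.of_forall fun x => ?_)
  have h2 : (Real.fourierChar (-inner ℝ x ξ) : ℂ) = ∏ i, (Real.fourierChar (-(x i * ξ i)) : ℂ) := by
    simp only [Real.fourierChar_apply, ← Complex.exp_sum, ← Finset.sum_mul, ← Complex.ofReal_sum,
      ← Finset.mul_sum, Finset.sum_neg_distrib, PiLp.inner_apply]
    simp [mul_comm]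
  by_cases hx : x ∈ cartesianPower n F <;> simp [hx, Circle.smul_def, h2]

lemma fourier_mollifiedIndicator {ε : ℝ} (hε : 0 < ε) (hFm : MeasurableSet F)
    (hF : F ⊆ Set.Icc 0 1) (ξ : EuclideanSpace ℝ (Fin n)) :
    𝓕 (fun x => (mollifiedIndicator ε (cartesianPower n F) x : ℂ)) ξ =
      (Real.exp (-2 * Real.pi ^ 2 * ε ^ 2 * ‖ξ‖ ^ 2) : ℝ) *
        ∏ i, 𝓕 (fun t => ((F.indicator (fun _ => (1 : ℝ)) t : ℝ) : ℂ)) (ξ i) := by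
  have hE : Integrable fun x =>
      (((cartesianPower n F).indicator (fun _ => (1 : ℝ)) x : ℝ) : ℂ) := by
    refine ((integrable_indicator_iff (measurableSet_cartesianPower hFm)).2 ?_).ofReal
    exact integrableOn_const (volume_cartesianPower_lt_top hF).ne
  have hG : Integrable fun x => (scaledGaussian n ε x : ℂ) := (integrable_scaledGaussian hε).ofReal
  rw [← fourier_scaledGaussian hε, ← fourier_indicator_cartesianPower hFm,
    ← Real.fourier_mul_convolution_eq hG hE]
  refine congrArg (fun g : EuclideanSpace ℝ (Fin n) → ℂ => 𝓕 g ξ) (funext fun x => ?_)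
  rw [mollifiedIndicator, convolution_def, convolution_def, ← integral_complex_ofReal]
  simp

lemma norm_le_sum_abs (ξ : EuclideanSpace ℝ (Fin n)) : ‖ξ‖ ≤ ∑ i, |ξ i| := by
  refine (pow_le_pow_iff_left₀ (norm_nonneg _) (Finset.sum_nonneg fun _ _ => abs_nonneg _)
    two_ne_zero).1 ?_
  rw [EuclideanSpace.real_norm_sq_eq]
  simpa using Finset.sum_sq_le_sq_sum_of_nonneg (s := Finset.univ) (f := fun i => |ξ i|)
    fun _ _ => abs_nonneg _

lemma exp_neg_norm_sq_eq_prod (c : ℝ) (ξ : EuclideanSpace ℝ (Fin n)) :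
    Real.exp (c * ‖ξ‖ ^ 2) = ∏ i, Real.exp (c * ξ i ^ 2) := by
  rw [EuclideanSpace.real_norm_sq_eq, Finset.mul_sum, Real.exp_sum]

/-- Both the Gaussian and $\hat{\mathbf 1}_{F^n}$ factor over coordinates. Bounding $|\xi|$ by
$\sum_i|\xi_i|$ puts the half-derivative on one coordinate at a time; in the others the Gaussian is
dropped and the remaining integral is at most $1$ by `h1`. -/
lemma sobolevHalfNormSq_mollifiedIndicator_le {ε : ℝ} (hε : 0 < ε) (hFm : MeasurableSet F)
    (hF : F ⊆ Set.Icc 0 1)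
    (h1 : ∫⁻ ξ : ℝ, ‖𝓕 (fun x => ((F.indicator (fun _ => (1 : ℝ)) x : ℝ) : ℂ)) ξ‖ₑ ^ 2 ≤ 1) :
    sobolevHalfNormSq (mollifiedIndicator ε (cartesianPower n F)) ≤
      n * mollifiedHalfNorm ε (F.indicator fun _ => 1) ^ 2 := by
  set f : ℝ → ℂ := 𝓕 (fun x => ((F.indicator (fun _ => (1 : ℝ)) x : ℝ) : ℂ)) with hf
  have hfc : Continuous f := by
    refine continuous_fourier_ofReal ((integrable_indicator_iff hFm).2 ?_)
    exact integrableOn_const ((measure_mono hF).trans_lt (by simp)).ne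
  have hwc := continuous_halfWeight ε
  -- Index $i$ marks the coordinate that carries the weight $|\xi_i|$, and $j$ runs over the
  -- factors.
  let q : Fin n → Fin n → ℝ → ℝ≥0∞ := fun i j t =>
    if j = i then ‖(halfWeight ε t : ℂ) * f t‖ₑ ^ 2 else ‖f t‖ₑ ^ 2
  have hq : ∀ i j, Measurable (q i j) := by
    intro i j
    by_cases hij : j = i
    · simp only [q, hij, if_true]
      exact (by fun_prop : Continuous _).measurable.enorm.pow_const 2
    · simp only [q, hij, if_false]
      exact hfc.measurable.enorm.pow_const 2
  have hpt : ∀ ξ : EuclideanSpace ℝ (Fin n),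
      ENNReal.ofReal (‖ξ‖ * ‖𝓕 (fun x => (mollifiedIndicator ε (cartesianPower n F) x : ℂ)) ξ‖ ^ 2) ≤
        ∑ i, ∏ j, q i j (ξ j) := by
    intro ξ
    have hterm : ∀ i, ENNReal.ofReal (|ξ i| *
        ∏ j, (Real.exp (-2 * Real.pi ^ 2 * ε ^ 2 * ξ j ^ 2) * ‖f (ξ j)‖) ^ 2) ≤
        ∏ j, q i j (ξ j) := by
      intro i
      rw [← Finset.mul_prod_erase _ _ (Finset.mem_univ i), ← mul_assoc,
        ← Finset.mul_prod_erase _ _ (Finset.mem_univ i), ENNReal.ofReal_mul (by positivity),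
        ENNReal.ofReal_prod_of_nonneg fun _ _ => by positivity]
      refine mul_le_mul' (le_of_eq ?_) (Finset.prod_le_prod' fun j hj => ?_)
      · simp only [q, if_true]
        rw [← ofReal_norm, ← ENNReal.ofReal_pow (norm_nonneg _), norm_mul, Complex.norm_real,
          Real.norm_of_nonneg (halfWeight_nonneg _ _), halfWeight, mul_pow, mul_pow, mul_pow,
          Real.sq_sqrt (abs_nonneg _), mul_assoc |ξ i|]
      · simp only [q, Finset.ne_of_mem_erase hj, if_false]
        rw [← ofReal_norm, ← ENNReal.ofReal_pow (norm_nonneg _)]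
        refine ENNReal.ofReal_le_ofReal (pow_le_pow_left₀ (by positivity) ?_ 2)
        refine mul_le_of_le_one_left (norm_nonneg _) (Real.exp_le_one_iff.2 ?_)
        have : 0 ≤ Real.pi ^ 2 * ε ^ 2 * ξ j ^ 2 := by positivity
        linarith
    refine le_trans ?_ (Finset.sum_le_sum fun i _ => hterm i)
    rw [← ENNReal.ofReal_sum_of_nonneg fun i _ =>
      mul_nonneg (abs_nonneg _) (Finset.prod_nonneg fun _ _ => by positivity), ← Finset.sum_mul]
    refine ENNReal.ofReal_le_ofReal ?_
    rw [fourier_mollifiedIndicator hε hFm hF, norm_mul, Complex.norm_real,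
      Real.norm_of_nonneg (Real.exp_nonneg _), norm_prod, exp_neg_norm_sq_eq_prod,
      ← Finset.prod_mul_distrib, ← Finset.prod_pow]
    exact mul_le_mul_of_nonneg_right (norm_le_sum_abs ξ)
      (Finset.prod_nonneg fun _ _ => by positivity)
  have hhalf : mollifiedHalfNorm ε (F.indicator fun _ => 1) ^ 2 =
      ∫⁻ t : ℝ, ‖(halfWeight ε t : ℂ) * f t‖ₑ ^ 2 := by
    rw [mollifiedHalfNorm, eLpNorm_eq_lintegral_rpow_enorm_toReal (by norm_num) (by norm_num),
      ← ENNReal.rpow_natCast, ← ENNReal.rpow_mul]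
    simp [hf]
  have hprod : ∀ i, ∫⁻ ξ : EuclideanSpace ℝ (Fin n), ∏ j, q i j (ξ j) ≤
      mollifiedHalfNorm ε (F.indicator fun _ => 1) ^ 2 := by
    intro i
    rw [← (PiLp.volume_preserving_toLp (Fin n)).lintegral_comp_emb
      (MeasurableEquiv.toLp 2 (Fin n → ℝ)).measurableEmbedding]
    simp only
    rw [lintegral_pi_prod_eq_prod (hq i), ← Finset.mul_prod_erase _ _ (Finset.mem_univ i), hhalf]
    refine (mul_le_of_le_one_right' (Finset.prod_le_one' fun j hj => ?_)).trans ?_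
    · simp only [q, Finset.ne_of_mem_erase hj, if_false]
      exact h1
    · simp only [q, if_true, le_refl]
  calc sobolevHalfNormSq (mollifiedIndicator ε (cartesianPower n F))
      ≤ ∫⁻ ξ : EuclideanSpace ℝ (Fin n), ∑ i, ∏ j, q i j (ξ j) := lintegral_mono hpt
    _ = ∑ i, ∫⁻ ξ : EuclideanSpace ℝ (Fin n), ∏ j, q i j (ξ j) := by
      refine lintegral_finsetSum _ fun i _ => Finset.measurable_prod _ fun j _ => ?_
      exact (hq i j).comp (by fun_prop)
    _ ≤ ∑ _i : Fin n, mollifiedHalfNorm ε (F.indicator fun _ => 1) ^ 2 :=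
      Finset.sum_le_sum fun i _ => hprod i
    _ = n * mollifiedHalfNorm ε (F.indicator fun _ => 1) ^ 2 := by simp

end Fourier

/-! ### The limit inferior and the conclusion -/

lemma liminf_sobolevHalfNormSq_eq_zero {F : Set ℝ} (hFm : MeasurableSet F)
    (hF : F ⊆ Set.Icc 0 1)
    (hscale : ∀ k : ℕ, ∃ ε : ℝ, 0 < ε ∧ ε < 1 / (k + 1) ∧
      mollifiedHalfNorm ε (F.indicator fun _ => 1) ^ 2 ≤ ENNReal.ofReal (|Real.log ε| / (k + 1)))
    (h1 : ∫⁻ ξ : ℝ, ‖𝓕 (fun x => ((F.indicator (fun _ => (1 : ℝ)) x : ℝ) : ℂ)) ξ‖ₑ ^ 2 ≤ 1)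
    (n : ℕ) :
    liminf (fun ε : ℝ => sobolevHalfNormSq (mollifiedIndicator ε (cartesianPower n F)) /
      ENNReal.ofReal |Real.log ε|) (𝓝[>] (0 : ℝ)) = 0 := by
  choose ε hε0 hε1 hε using hscale
  have hεlim : Tendsto ε atTop (𝓝[>] 0) := by
    refine tendsto_nhdsWithin_iff.2 ⟨?_, .of_forall hε0⟩
    exact squeeze_zero (fun k => (hε0 k).le) (fun k => (hε1 k).le)
      tendsto_one_div_add_atTop_nhds_zero_nat
  -- Smallness along the single sequence $\varepsilon_k\to0^+$ is enough for a limit inferior.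
  have hbound : ∀ k, sobolevHalfNormSq (mollifiedIndicator (ε k) (cartesianPower n F)) /
      ENNReal.ofReal |Real.log (ε k)| ≤ ENNReal.ofReal (n / ((k : ℝ) + 1)) := by
    intro k
    refine ENNReal.div_le_of_le_mul ?_
    refine (sobolevHalfNormSq_mollifiedIndicator_le (hε0 k) hFm hF h1).trans ?_
    refine (mul_le_mul_right (hε k) _).trans (le_of_eq ?_)
    rw [← ENNReal.ofReal_natCast, ← ENNReal.ofReal_mul (by positivity),
      ← ENNReal.ofReal_mul (by positivity)]
    congr 1
    ring
  have hzero : Tendsto (fun k : ℕ => ENNReal.ofReal (n / ((k : ℝ) + 1))) atTop (𝓝 0) := by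
    have := (tendsto_one_div_add_atTop_nhds_zero_nat (𝕜 := ℝ)).const_mul (n : ℝ)
    simpa only [mul_one_div, mul_zero, ENNReal.ofReal_zero] using ENNReal.tendsto_ofReal this
  refine le_antisymm (le_of_forall_gt_imp_ge_of_dense fun c hc => ?_) zero_le
  refine liminf_le_of_frequently_le' (hεlim.frequently (Eventually.frequently ?_))
  filter_upwards [hzero.eventually_lt_const hc] with k hk
  exact (hbound k).trans hk.le

theorem mainTheorem3 :
    ∃ F : Set ℝ, MeasurableSet F ∧ F ⊆ Set.Icc 0 1 ∧ 0 < volume F ∧ volume F < 1 ∧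
      ∀ n : ℕ, 0 < n →
        perimeter (cartesianPower n F) = ⊤ ∧
        liminf (fun ε : ℝ =>
            sobolevHalfNormSq (mollifiedIndicator ε (cartesianPower n F)) /
              ENNReal.ofReal |Real.log ε|) (𝓝[>] (0 : ℝ)) = 0 := by
  obtain ⟨F, hFm, hF, hwave, hscale, h1⟩ := exists_oscillating_set
  have hF' : F ⊆ Set.Icc 0 1 := hF.trans (Set.Icc_subset_Icc (by norm_num) (by norm_num))
  -- A null set would have zero pairing with every wave, against the lower bound for $k=1$.
  have hpos : 0 < volume F := by
    rw [pos_iff_ne_zero]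
    intro h0
    obtain ⟨N, hN⟩ := hwave 1
    rw [setIntegral_measure_zero _ h0] at hN
    norm_num at hN
  refine ⟨F, hFm, hF', hpos, (measure_mono hF).trans_lt ?_, fun n hn =>
    ⟨perimeter_cartesianPower_eq_top hFm hF' hpos hwave hn,
      liminf_sobolevHalfNormSq_eq_zero hFm hF' hscale h1 n⟩⟩
  rw [Real.volume_Icc, ← ENNReal.ofReal_one]
  exact (ENNReal.ofReal_lt_ofReal_iff (by norm_num)).2 (by norm_num)
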